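/- Let $n\ge 0$, let $P\subset\mathbb R^{n+1}$ be open, and let $\psi\colon P\to\mathbb R$ be smooth, proper and bounded above (so $\psi(x)\to-\infty$ as $x\to\partial P$ or $|x|\to\infty$). Let $\mathcal O=\{(x,y)\in\mathbb R^{n+1}\times\mathbb R : x\in P,\ y<\psi(x)\}$ be the associated obstacle in $\mathbb R^{n+2}$, and let $\operatorname{dist}_{\partial\mathcal O}$ be the signed Euclidean distance to $\partial\mathcal O$, negative in $\mathcal O$. Let $\beta\in C^\infty(\mathbb R,[0,\infty))$ be not identically zero, supported in $(-\infty,0]$, with $\beta''$ non-increasing, and for $\varepsilon>0$ set $\alpha_\varepsilon(p)=\beta(\operatorname{dist}_{\partial\mathcal O}(p)/\varepsilon)$. Then there are functions $C_0\colon\mathbb R\to(1,\infty)$ and $\varepsilon_0\colon\mathbb R\to(0,\infty)$, depending only on $n,P,\psi,\beta$, with the following property. Let $\ell\in\mathbb R$, $L<\ell$, and let $R>0$ be such that $\psi<L$ on $P\setminus B_R(0)$. Let $0<\varepsilon\le\varepsilon_0(L)$, let $T\in(0,\infty]$, let $u_0\colon B_R(0)\to\mathbb R$ satisfy $u_0\ge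 L$ in $B_R(0)$ and $u_0\ge\psi$ in $B_R(0)\cap P$, and let $u$ be a classical solution (continuous on $\overline{B_R(0)}\times[0,T)$ and, for $0<t<T$, of class $C^2$ in $x\in B_R(0)$ and differentiable in $t$) of $$\begin{cases}\dot u=\sqrt{1+|Du|^2}\left(\operatorname{div}\left(\dfrac{Du}{\sqrt{1+|Du|^2}}\right)+\alpha_\varepsilon(x,u)\right)&\text{in }B_R(0)\times(0,T),\\ u=L&\text{on }\partial B_R(0)\times[0,T),\\ u(\cdot,0)=u_0&\text{in }B_R(0).\end{cases}$$ Then for every $t\in[0,T)$ and every point $p$ of $M_t=\{(x,u(x,t)):x\in B_R(0)\}$ whose last coordinate is at least $\ell$, $$\operatorname{dist}_{\partial\mathcal O}(p)\ge -C_0(\ell)\,\varepsilon .$$ In particular the bound $C_0(\ell)$ does not depend on the truncation level $L$, and $\varepsilon_0(L)$ does not depend on $\ell$ or $R$. -/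

import Mathlib

open Set Metric
open scoped ContDiff

noncomputable section

namespace ObstacleMCF

/-- The base space `ℝⁿ⁺¹`. -/
abbrev Base (n : ℕ) : Type := EuclideanSpace ℝ (Fin (n + 1))

/-- The ambient space `ℝⁿ⁺² = ℝⁿ⁺¹ × ℝ` with the Euclidean norm `√(‖x‖² + y²)`;
`p.fst` is the base point and `p.snd` is the height of `p`. -/
abbrev Ambient (n : ℕ) : Type := WithLp 2 (Base n × ℝ)

/-- The point `(x, y)` of the ambient space. -/
def pt {n : ℕ} (x : Base n) (y : ℝ) : Ambient n := WithLp.toLp 2 (x, y)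

/-- The obstacle `𝒪 = {(x, y) : x ∈ P, y < ψ x}`. Only the values of `ψ` on `P` matter. -/
def obstacle {n : ℕ} (P : Set (Base n)) (ψ : Base n → ℝ) : Set (Ambient n) :=
  {p | p.fst ∈ P ∧ p.snd < ψ p.fst}

/-- The data of a smooth obstacle: `P` is open, and `ψ : P → ℝ` is smooth, proper and bounded
above. -/
structure IsSmoothObstacle {n : ℕ} (P : Set (Base n)) (ψ : Base n → ℝ) : Prop where
  isOpen : IsOpen P
  smooth : ContDiffOn ℝ ∞ ψ P
  proper : IsProperMap (fun x : P => ψ x)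
  bddAbove : BddAbove (ψ '' P)

open Classical in
/-- The signed Euclidean distance to the boundary of `O`, negative in `O`. -/
def signedDistFrontier {n : ℕ} (O : Set (Ambient n)) (p : Ambient n) : ℝ :=
  if p ∈ O then -infDist p (frontier O) else infDist p (frontier O)

/-- The profile of the penalisation: a smooth function `β : ℝ → [0, ∞)`, not identically zero,
supported in `(-∞, 0]`, with non-increasing second derivative. -/
structure IsPenaltyProfile (β : ℝ → ℝ) : Prop where
  smooth : ContDiff ℝ ∞ β
  nonneg : ∀ s, 0 ≤ β s
  support_subset : Function.support β ⊆ Iic 0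
  antitone_deriv2 : Antitone (deriv (deriv β))
  nontrivial : ∃ s, β s ≠ 0

/-- The penalisation `α_ε(p) = β (dist_{∂O}(p) / ε)`. -/
def penalty {n : ℕ} (β : ℝ → ℝ) (O : Set (Ambient n)) (ε : ℝ) (p : Ambient n) : ℝ :=
  β (signedDistFrontier O p / ε)

/-- The divergence `∑ᵢ ∂ᵢ Vᵢ` of a vector field on `ℝⁿ⁺¹`. -/
def divergence {n : ℕ} (V : Base n → Base n) (x : Base n) : ℝ :=
  ∑ i, (fderiv ℝ V x (EuclideanSpace.single i 1)) i

/-- `√(1 + |Dw|²)` -/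
def areaFactor {n : ℕ} (w : Base n → ℝ) (x : Base n) : ℝ :=
  √(1 + ‖gradient w x‖ ^ 2)

/-- `div (Dw / √(1 + |Dw|²))` -/
def divNormalizedGrad {n : ℕ} (w : Base n → ℝ) (x : Base n) : ℝ :=
  divergence (fun z => (areaFactor w z)⁻¹ • gradient w z) x

/-- `u` is a classical solution on `B_R(0) × [0, T)`, `T ∈ (0, ∞]`, of the Dirichlet problem for
the penalised graphical flow
`u̇ = √(1 + |Du|²) (div (Du / √(1 + |Du|²)) + α_ε(x, u))`
with boundary value `L` on `∂B_R(0)` and initial value `u₀` in `B_R(0)`. It is continuous on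
`closedBall 0 R × [0, T)`, and for `0 < t < T` it is `C²` in `x`, differentiable in `t`, and
satisfies the equation. -/
structure IsPenalisedSolution {n : ℕ} (β : ℝ → ℝ) (O : Set (Ambient n)) (ε L R : ℝ) (T : EReal)
    (u₀ : Base n → ℝ) (u : Base n → ℝ → ℝ) : Prop where
  continuousOn : ContinuousOn (fun q : Base n × ℝ => u q.1 q.2)
    (closedBall 0 R ×ˢ {t : ℝ | 0 ≤ t ∧ (t : EReal) < T})
  contDiffOn_space : ∀ t : ℝ, 0 < t → (t : EReal) < T →
    ContDiffOn ℝ 2 (fun x => u x t) (ball 0 R)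
  hasDerivAt_time : ∀ t : ℝ, 0 < t → (t : EReal) < T → ∀ x ∈ ball (0 : Base n) R,
    HasDerivAt (fun s => u x s)
      (areaFactor (fun z => u z t) x *
        (divNormalizedGrad (fun z => u z t) x + penalty β O ε (pt x (u x t)))) t
  boundary : ∀ t : ℝ, 0 ≤ t → (t : EReal) < T → ∀ x ∈ sphere (0 : Base n) R, u x t = L
  initial : ∀ x ∈ ball (0 : Base n) R, u x 0 = u₀ x

/-- The graph of `w` over `B_R(0)`. -/
def graphOver {n : ℕ} (R : ℝ) (w : Base n → ℝ) : Set (Ambient n) :=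
  {p | p.fst ∈ ball (0 : Base n) R ∧ p.snd = w p.fst}

end ObstacleMCF

end

namespace ObstacleMCF

open Filter Topology

variable {n : ℕ}

/-! The barrier is `w = ψ - ε f(ψ)`, the graph of `ψ` lowered by `ε` times a positive smooth
function of height. Since `β` is convex and nonzero, it tends to infinity at `-∞`, so `f` can be
chosen once and for all such that the penalty at vertical depth at least `ε f(ψ x)` exceeds the
curvature of the graph of `ψ` by 1 (`exists_depth_profile`). For small `ε` the lowering costs at
most 1 of curvature on the compact set `{ψ ≥ L}`, and the depth stays at a scale where the obstacle
contains balls of comparable radius; this fixes `ε₀(L)`. Then `w` is a stationary subsolution on `{ψ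
> L}`.

Where `ψ = L`, `w < L ≤ u` by comparison with the constant `L`; initially `w < ψ ≤ u₀`. Hence `w ≤
u` (`IsPenalisedSolution.le_of_subsolution`). A point of the graph of `u` inside the obstacle at
height at least `ℓ` lies over `{ψ ≥ ℓ}`, so its depth is at most `ε` times the maximum of `f ∘ ψ`
there. As `f` was chosen before `L`, this maximum depends on `ℓ` only. -/

/-- The mean curvature `div (Dw / √(1 + |Dw|²))` as a function of `g = Dw` and `B = D²w`. -/
noncomputable def meanCurvatureForm (g : Base n) (B : Base n →L[ℝ] Base n) : ℝ :=
  (√(1 + ‖g‖ ^ 2))⁻¹ *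
    (∑ i, (B (EuclideanSpace.single i 1)) i - inner ℝ g (B g) / (1 + ‖g‖ ^ 2))

/-! ### Ellipticity and continuity of the mean curvature operator -/

lemma inner_single_one_left (i : Fin (n + 1)) (y : Base n) :
    inner ℝ (EuclideanSpace.single i (1 : ℝ)) y = y i := by
  simp [EuclideanSpace.inner_single_left]

lemma apply_eq_sum_single (B : Base n →L[ℝ] Base n) (g : Base n) :
    B g = ∑ j, g j • B (EuclideanSpace.single j (1 : ℝ)) := by
  have : g = ∑ i, g i • (EuclideanSpace.single i (1 : ℝ)) := by
    ext j; simp [Finset.sum_apply, Pi.single_apply]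
  conv_lhs => rw [this]
  simp

lemma contDiffAt_gradient {w : Base n → ℝ} {x : Base n} (hw : ContDiffAt ℝ 2 w x) :
    ContDiffAt ℝ 1 (gradient w) x := by
  have h : ContDiffAt ℝ 1 (fderiv ℝ w) x := hw.fderiv_right (by norm_num)
  exact (InnerProductSpace.toDual ℝ (Base n)).symm.contDiff.contDiffAt.comp x h

lemma divNormalizedGrad_eq {w : Base n → ℝ} {x : Base n} (hw : ContDiffAt ℝ 2 w x) :
    divNormalizedGrad w x = meanCurvatureForm (gradient w x) (fderiv ℝ (gradient w) x) := by
  set G := gradient w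
  have hGd : HasFDerivAt G (fderiv ℝ G x) x :=
    ((contDiffAt_gradient hw).differentiableAt (by norm_num)).hasFDerivAt
  set B := fderiv ℝ G x
  have hpos : 0 < 1 + ‖G x‖ ^ 2 := by positivity
  have hA : HasFDerivAt (fun z => areaFactor w z)
      ((1 / (2 * √(1 + ‖G x‖ ^ 2))) • (2 • (innerSL ℝ (G x)).comp B)) x := by
    simpa only [areaFactor] using (hGd.norm_sq.const_add 1).sqrt hpos.ne'
  have hs : √(1 + ‖G x‖ ^ 2) ≠ 0 := (Real.sqrt_pos.2 hpos).ne'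
  have hAi := hasDerivAt_inv (x := areaFactor w x) (by simpa only [areaFactor] using hs)
  have hV := (hAi.comp_hasFDerivAt x hA).smul hGd
  have hfd := hV.fderiv
  unfold divNormalizedGrad divergence
  have hfd' : fderiv ℝ (fun z => (areaFactor w z)⁻¹ • gradient w z) x = _ := hfd
  rw [hfd']
  have hsq : (√(1 + ‖G x‖ ^ 2)) ^ 2 = 1 + ‖G x‖ ^ 2 := Real.sq_sqrt hpos.le
  have hBG : inner ℝ (G x) (B (G x)) =
      ∑ i, inner ℝ (G x) (B (EuclideanSpace.single i 1)) * G x i := by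
    rw [apply_eq_sum_single, inner_sum]
    simp [inner_smul_right, mul_comm]
  have ha : areaFactor w x = √(1 + ‖G x‖ ^ 2) := rfl
  unfold meanCurvatureForm
  rw [hBG]
  simp only [Function.comp_apply, ha]
  clear hfd hfd' hV hA hAi
  generalize √(1 + ‖G x‖ ^ 2) = a at *
  rw [← hsq]
  simp only [_root_.add_apply, _root_.smul_apply, ContinuousLinearMap.smulRight_apply,
    PiLp.add_apply, PiLp.smul_apply, smul_eq_mul,
    ContinuousLinearMap.comp_apply, innerSL_apply_apply, nsmul_eq_mul, Finset.sum_add_distrib]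
  rw [mul_sub, Finset.mul_sum, Finset.sum_div, Finset.mul_sum, sub_eq_add_neg,
    ← Finset.sum_neg_distrib]
  congr 1
  refine Finset.sum_congr rfl fun i _ => ?_
  push_cast
  field_simp

/-- Nonnegativity is tested on the vectors `g j • e i - g i • e j` and summed over all pairs.
Neither symmetry of `C` nor a diagonalisation is needed. -/
lemma inner_le_trace_of_nonneg {C : Base n →L[ℝ] Base n} (hC : ∀ h, 0 ≤ inner ℝ h (C h))
    (g : Base n) : inner ℝ g (C g) ≤ ‖g‖ ^ 2 * ∑ i, (C (EuclideanSpace.single i 1)) i := by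
  set c : Fin (n + 1) → Fin (n + 1) → ℝ := fun i j => (C (EuclideanSpace.single j 1)) i with hc
  have hexp : inner ℝ g (C g) = ∑ i, ∑ j, g i * g j * c i j := by
    rw [PiLp.inner_apply]
    refine Finset.sum_congr rfl fun i _ => ?_
    rw [apply_eq_sum_single C g]
    simp [Finset.sum_apply, Finset.sum_mul, hc]
    refine Finset.sum_congr rfl fun j _ => by ring
  have hpair : ∀ i j, g i * g j * c i j + g j * g i * c j i ≤ g i ^ 2 * c j j + g j ^ 2 * c i i := by
    intro i j
    have := hC (g j • EuclideanSpace.single i (1 : ℝ) - g i • EuclideanSpace.single j (1 : ℝ))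
    simp only [map_sub, map_smul, inner_sub_left, inner_sub_right, real_inner_smul_left,
      real_inner_smul_right, inner_single_one_left] at this
    simp only [hc]
    nlinarith
  have hsum := Finset.sum_le_sum fun i (_ : i ∈ Finset.univ) =>
    Finset.sum_le_sum fun j (_ : j ∈ Finset.univ) => hpair i j
  simp only [Finset.sum_add_distrib] at hsum
  rw [Finset.sum_comm (f := fun i j => g j * g i * c j i),
    Finset.sum_comm (f := fun i j => g j ^ 2 * c i i)] at hsum
  have hn : ‖g‖ ^ 2 = ∑ i, g i ^ 2 := by simp [EuclideanSpace.norm_sq_eq]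
  have hprod : ‖g‖ ^ 2 * ∑ i, c i i = ∑ i, ∑ j, g i ^ 2 * c j j := by
    rw [hn, Finset.sum_mul_sum]
  rw [hexp]
  change _ ≤ ‖g‖ ^ 2 * ∑ i, c i i
  linarith

lemma meanCurvatureForm_mono (g : Base n) {B B' : Base n →L[ℝ] Base n}
    (h : ∀ v, 0 ≤ inner ℝ v ((B' - B) v)) : meanCurvatureForm g B ≤ meanCurvatureForm g B' := by
  unfold meanCurvatureForm
  refine mul_le_mul_of_nonneg_left ?_ (by positivity)
  have htr := inner_le_trace_of_nonneg h g
  have h0 : 0 ≤ ∑ i, ((B' - B) (EuclideanSpace.single i 1)) i :=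
    Finset.sum_nonneg fun i _ => inner_single_one_left i _ ▸ h (EuclideanSpace.single i 1)
  have hq : inner ℝ g ((B' - B) g) / (1 + ‖g‖ ^ 2) ≤
      ∑ i, ((B' - B) (EuclideanSpace.single i 1)) i := by
    rw [div_le_iff₀ (by positivity)]
    nlinarith
  simp only [_root_.sub_apply, inner_sub_right, sub_div, PiLp.sub_apply,
    Finset.sum_sub_distrib] at hq
  linarith

lemma continuous_meanCurvatureForm :
    Continuous fun q : Base n × (Base n →L[ℝ] Base n) => meanCurvatureForm q.1 q.2 := by
  unfold meanCurvatureForm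
  have hpos : ∀ q : Base n × (Base n →L[ℝ] Base n), 0 < 1 + ‖q.1‖ ^ 2 := fun q => by positivity
  refine Continuous.mul (Continuous.inv₀ (by fun_prop) fun q => (Real.sqrt_pos.2 (hpos q)).ne') ?_
  refine Continuous.sub ?_ (Continuous.div (by fun_prop) (by fun_prop) fun q => (hpos q).ne')
  fun_prop

/-! ### Derivative tests at a minimum -/

lemma gradient_sub_mul {f g : Base n → ℝ} {x : Base n} (c : ℝ) (hf : DifferentiableAt ℝ f x)
    (hg : DifferentiableAt ℝ g x) :
    gradient (fun z => f z - c * g z) x = gradient f x - c • gradient g x := by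
  unfold gradient
  rw [fderiv_fun_sub hf (hg.const_mul c), fderiv_const_mul hg]
  simp

lemma fderiv_gradient_sub_mul {f g : Base n → ℝ} {x : Base n} (c : ℝ) (hf : ContDiffAt ℝ 2 f x)
    (hg : ContDiffAt ℝ 2 g x) :
    fderiv ℝ (gradient fun z => f z - c * g z) x =
      fderiv ℝ (gradient f) x - c • fderiv ℝ (gradient g) x := by
  have hev : gradient (fun z => f z - c * g z) =ᶠ[𝓝 x] fun z => gradient f z - c • gradient g z := by
    filter_upwards [hf.eventually (by simp), hg.eventually (by simp)] with z hfz hgz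
    exact gradient_sub_mul c (hfz.differentiableAt (by norm_num)) (hgz.differentiableAt (by norm_num))
  rw [hev.fderiv_eq]
  have h1 := (contDiffAt_gradient hf).differentiableAt (by norm_num)
  have h2 := (contDiffAt_gradient hg).differentiableAt (by norm_num)
  exact (h1.hasFDerivAt.sub (h2.hasFDerivAt.const_smul c)).fderiv

/-- A negative second derivative would make `a` a local maximum as well, so `f` would be locally
constant with vanishing second derivative. -/
lemma _root_.IsLocalMin.deriv_deriv_nonneg {f : ℝ → ℝ} {a : ℝ} (h : IsLocalMin f a)
    (hc : ContinuousAt f a) : 0 ≤ deriv (deriv f) a := by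
  by_contra! hneg
  have hmax := isLocalMax_of_deriv_deriv_neg hneg h.deriv_eq_zero hc
  have hconst : f =ᶠ[𝓝 a] fun _ => f a := by
    filter_upwards [h, hmax] with z h1 h2 using le_antisymm h2 h1
  have : deriv (deriv f) a = 0 := by
    rw [hconst.deriv.deriv_eq]; simp
  linarith

lemma gradient_eq_zero_of_isLocalMin {v : Base n → ℝ} {x : Base n} (h : IsLocalMin v x) :
    gradient v x = 0 := by
  simp [gradient, h.fderiv_eq_zero]

lemma inner_fderiv_gradient_nonneg_of_isLocalMin {v : Base n → ℝ} {x : Base n}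
    (hv : ContDiffAt ℝ 2 v x) (h : IsLocalMin v x) (e : Base n) :
    0 ≤ inner ℝ e (fderiv ℝ (gradient v) x e) := by
  have hline : ∀ s : ℝ, HasDerivAt (fun s : ℝ => x + s • e) e s := fun s => by
    simpa using ((hasDerivAt_id s).smul_const e).const_add x
  have hc : Tendsto (fun s : ℝ => x + s • e) (𝓝 0) (𝓝 x) := by
    simpa using (hline 0).continuousAt.tendsto
  have hx : x + (0 : ℝ) • e = x := by simp
  have hmin : IsLocalMin (fun s : ℝ => v (x + s • e)) 0 := by
    filter_upwards [hc.eventually h] with s hs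
    simpa using hs
  have hcont : ContinuousAt (fun s : ℝ => v (x + s • e)) 0 :=
    ContinuousAt.comp (by simpa using hv.continuousAt) (hline 0).continuousAt
  have hd : deriv (fun s : ℝ => v (x + s • e)) =ᶠ[𝓝 0] fun s => inner ℝ e (gradient v (x + s • e)) := by
    filter_upwards [hc.eventually (hv.eventually (by simp))] with s hs
    have := (hs.differentiableAt (by norm_num)).hasFDerivAt.comp_hasDerivAt s (hline s)
    refine this.deriv.trans ?_
    rw [inner_gradient_right]; simp
  have h2 : HasDerivAt (fun s : ℝ => gradient v (x + s • e)) (fderiv ℝ (gradient v) x e) 0 := by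
    have hg := ((contDiffAt_gradient hv).differentiableAt (by norm_num)).hasFDerivAt
    rw [← hx] at hg
    have := hg.comp_hasDerivAt 0 (hline 0)
    rwa [hx] at this
  have h3 := ((hasDerivAt_const (0 : ℝ) e).inner ℝ h2).deriv
  have := hmin.deriv_deriv_nonneg hcont
  rw [hd.deriv_eq, h3] at this
  simpa using this

/-- Only earlier times are compared, because the space-time minimum may sit at the final time. -/
lemma nonpos_of_hasDerivAt_of_forall_le_left {f : ℝ → ℝ} {f' a b : ℝ} (hab : b < a)
    (hf : HasDerivAt f f' a) (hmin : ∀ s ∈ Ioo b a, f a ≤ f s) : f' ≤ 0 := by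
  have ht := (hasDerivAt_iff_tendsto_slope_left_right.1 hf).1
  refine le_of_tendsto ht ?_
  filter_upwards [Ioo_mem_nhdsLT hab] with s hs
  rw [slope_def_field]
  exact div_nonpos_of_nonneg_of_nonpos (sub_nonneg.2 (hmin s hs)) (sub_nonpos.2 hs.2.le)

/-- Comparison of a solution with a stationary subsolution `w` on a compact set `K`, where the
order is known on `K \ U`. -/
lemma IsPenalisedSolution.le_of_subsolution {β : ℝ → ℝ} {O : Set (Ambient n)} {ε L R : ℝ}
    {T : EReal} {u₀ w : Base n → ℝ} {u : Base n → ℝ → ℝ}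
    (hu : IsPenalisedSolution β O ε L R T u₀ u) {K U : Set (Base n)} (hK : IsCompact K)
    (hKb : K ⊆ closedBall 0 R) (hU : IsOpen U) (hUK : U ⊆ K) (hUb : U ⊆ ball 0 R)
    (hwc : ContinuousOn w K) (hw : ∀ x ∈ U, ContDiffAt ℝ 2 w x)
    (hsub : ∀ x ∈ U, ∀ y ≤ w x, 0 ≤ divNormalizedGrad w x + penalty β O ε (pt x y))
    (hbd : ∀ x ∈ K, x ∉ U → ∀ t : ℝ, 0 ≤ t → (t : EReal) < T → w x ≤ u x t)
    (hinit : ∀ x ∈ K, w x ≤ u x 0) (t : ℝ) (ht0 : 0 ≤ t) (htT : (t : EReal) < T) (x : Base n)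
    (hx : x ∈ K) : w x ≤ u x t := by
  by_contra! hlt
  -- The term `δ * s` makes the time inequality at the minimum strict; `δ` is small enough to keep
  -- the minimum of `g` negative.
  obtain ⟨δ, hδ, hδt⟩ : ∃ δ : ℝ, 0 < δ ∧ δ * t < w x - u x t := by
    refine ⟨(w x - u x t) / (t + 1), div_pos (by linarith) (by linarith), ?_⟩
    rw [div_mul_eq_mul_div, div_lt_iff₀ (by linarith)]
    nlinarith
  have hTs : ∀ s ∈ Icc (0 : ℝ) t, (s : EReal) < T := fun s hs =>
    lt_of_le_of_lt (EReal.coe_le_coe_iff.2 hs.2) htT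
  set g : Base n × ℝ → ℝ := fun q => u q.1 q.2 - w q.1 + δ * q.2 with hg
  have hgc : ContinuousOn g (K ×ˢ Icc 0 t) := by
    refine ContinuousOn.add (ContinuousOn.sub (hu.continuousOn.mono ?_) ?_) (by fun_prop)
    · exact prod_mono hKb fun s hs => ⟨hs.1, hTs s hs⟩
    · exact hwc.comp continuousOn_fst fun q hq => hq.1
  obtain ⟨⟨z, s⟩, ⟨hzK, hs⟩, hmin⟩ :=
    (hK.prod isCompact_Icc).exists_isMinOn ⟨(x, t), hx, ht0, le_rfl⟩ hgc
  have hneg : g (z, s) < 0 := by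
    have := isMinOn_iff.1 hmin (x, t) ⟨hx, ht0, le_rfl⟩
    refine this.trans_lt ?_
    simp only [hg]; linarith
  have hs0 : 0 < s := by
    refine lt_of_le_of_ne hs.1 fun h => ?_
    subst h
    have := hinit z hzK
    simp only [hg] at hneg
    linarith
  have hδs : 0 < δ * s := mul_pos hδ hs0
  have hzw : u z s < w z := by simp only [hg] at hneg; linarith
  have hzU : z ∈ U := by
    by_contra h
    exact absurd (hbd z hzK h s hs.1 (hTs s hs)) (not_le.2 hzw)
  have huz : ContDiffAt ℝ 2 (fun y => u y s) z :=
    (hu.contDiffOn_space s hs0 (hTs s hs)).contDiffAt (isOpen_ball.mem_nhds (hUb hzU))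
  have hlmin : IsLocalMin (fun y => u y s - 1 * w y) z := by
    filter_upwards [hU.mem_nhds hzU] with y hy
    have := isMinOn_iff.1 hmin (y, s) ⟨hUK hy, hs⟩
    simp only [hg] at this
    linarith
  have hgrad := gradient_eq_zero_of_isLocalMin hlmin
  rw [gradient_sub_mul 1 (huz.differentiableAt (by norm_num))
    ((hw z hzU).differentiableAt (by norm_num)), one_smul, sub_eq_zero] at hgrad
  have hhess := inner_fderiv_gradient_nonneg_of_isLocalMin
    (huz.sub (contDiffAt_const.mul (hw z hzU))) hlmin
  rw [fderiv_gradient_sub_mul 1 huz (hw z hzU), one_smul] at hhess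
  -- At the minimum the gradients agree and the Hessians are ordered, so ellipticity orders the
  -- curvatures.
  have hH : divNormalizedGrad w z ≤ divNormalizedGrad (fun y => u y s) z := by
    rw [divNormalizedGrad_eq huz, divNormalizedGrad_eq (hw z hzU), hgrad]
    exact meanCurvatureForm_mono _ hhess
  have htime := (hu.hasDerivAt_time s hs0 (hTs s hs) z (hUb hzU)).add
    ((hasDerivAt_id s).const_mul δ)
  have hle := nonpos_of_hasDerivAt_of_forall_le_left hs0 htime fun r hr => by
    have := isMinOn_iff.1 hmin (z, r) ⟨hzK, hr.1.le, hr.2.le.trans hs.2⟩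
    simp only [hg] at this
    simp only [Pi.add_apply, id]
    linarith
  have hA : 0 ≤ areaFactor (fun y => u y s) z := Real.sqrt_nonneg _
  have := mul_nonneg hA (show 0 ≤ divNormalizedGrad (fun y => u y s) z +
    penalty β O ε (pt z (u z s)) by linarith [hsub z hzU _ hzw.le])
  linarith

lemma divNormalizedGrad_const (c : ℝ) (x : Base n) :
    divNormalizedGrad (fun _ : Base n => c) x = 0 := by
  simp [divNormalizedGrad, divergence, gradient_fun_const']

/-- The constant `L` is a subsolution because the penalty is nonnegative. -/
lemma IsPenalisedSolution.boundaryValue_le {β : ℝ → ℝ} {O : Set (Ambient n)} {ε L R : ℝ}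
    {T : EReal} {u₀ : Base n → ℝ} {u : Base n → ℝ → ℝ}
    (hu : IsPenalisedSolution β O ε L R T u₀ u) (hβ : ∀ s, 0 ≤ β s)
    (h₀ : ∀ x ∈ ball (0 : Base n) R, L ≤ u₀ x) (t : ℝ) (ht0 : 0 ≤ t) (htT : (t : EReal) < T)
    (x : Base n) (hx : x ∈ closedBall 0 R) : L ≤ u x t := by
  have hsphere : ∀ z ∈ closedBall (0 : Base n) R, z ∉ ball (0 : Base n) R → z ∈ sphere 0 R :=
    fun z hz hz' => le_antisymm hz (not_lt.1 hz')
  refine hu.le_of_subsolution (w := fun _ => L) (isCompact_closedBall 0 R) subset_rfl isOpen_ball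
    ball_subset_closedBall subset_rfl continuousOn_const (fun _ _ => contDiffAt_const) ?_ ?_ ?_
    t ht0 htT x hx
  · intro z _ y _
    rw [divNormalizedGrad_const, zero_add]
    exact hβ _
  · exact fun z hz hz' s hs0 hsT => (hu.boundary s hs0 hsT z (hsphere z hz hz')).ge
  · intro z hz
    by_cases hz' : z ∈ ball (0 : Base n) R
    · exact (h₀ z hz').trans_eq (hu.initial z hz').symm
    · exact (hu.boundary 0 le_rfl (lt_of_le_of_lt (EReal.coe_le_coe_iff.2 ht0) htT) z
        (hsphere z hz hz')).ge

/-! ### Growth of the penalty profile -/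

lemma IsPenaltyProfile.tendsto_atBot {β : ℝ → ℝ} (hβ : IsPenaltyProfile β) :
    Tendsto β atBot atTop := by
  have hzero : ∀ s, 0 < s → β s = 0 := fun s hs => by
    by_contra h
    exact absurd (hβ.support_subset h) (not_le.2 hs)
  have hd2 : ∀ s, 0 < s → deriv (deriv β) s = 0 := fun s hs => by
    have h : β =ᶠ[𝓝 s] fun _ => 0 := by
      filter_upwards [lt_mem_nhds hs] with r hr using hzero r hr
    rw [h.deriv.deriv_eq]; simp
  -- The second derivative is non-increasing and vanishes on the positive axis, hence is nonnegative
  -- everywhere.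
  have hconv : ConvexOn ℝ univ β := by
    refine convexOn_univ_of_deriv2_nonneg (hβ.smooth.differentiable (by simp)) ?_ fun s => ?_
    · exact (hβ.smooth.of_le (m := 2) ENat.LEInfty.out).differentiable_deriv_two
    · calc (0 : ℝ) = deriv (deriv β) (max s 1) := (hd2 _ (by positivity)).symm
        _ ≤ deriv (deriv β) s := hβ.antitone_deriv2 (le_max_left _ _)
  obtain ⟨a, ha⟩ := hβ.nontrivial
  have ha0 : a ≤ 0 := hβ.support_subset ha
  have hapos : 0 < β a := lt_of_le_of_ne (hβ.nonneg a) (Ne.symm ha)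
  -- To the left of `a`, convexity keeps `β` above the line through `(a, β a)` and `(1, 0)`, which
  -- has negative slope.
  have hlin : ∀ s < a, β a / (1 - a) * (1 - s) ≤ β s := fun s hs => by
    have h := hconv.slope_mono_adjacent (mem_univ s) (mem_univ (1 : ℝ)) hs (by linarith)
    rw [hzero 1 one_pos, zero_sub] at h
    rw [div_le_div_iff₀ (by linarith) (by linarith)] at h
    rw [div_mul_eq_mul_div, div_le_iff₀ (by linarith)]
    nlinarith
  refine tendsto_atTop_mono' atBot ((eventually_lt_atBot a).mono hlin) ?_
  exact (tendsto_atTop_add_const_left _ 1 tendsto_neg_atBot_atTop).const_mul_atTop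
    (div_pos hapos (by linarith))

/-! ### Signed distance versus vertical depth -/

lemma dist_pt_pt (x : Base n) (y y' : ℝ) : dist (pt x y) (pt x y') = |y - y'| := by
  rw [WithLp.prod_dist_eq_of_L2]
  simp [pt, Real.dist_eq, Real.sqrt_sq_eq_abs]

lemma pt_mem_frontier_obstacle {P : Set (Base n)} (ψ : Base n → ℝ) {x : Base n} (hx : x ∈ P) :
    pt x (ψ x) ∈ frontier (obstacle P ψ) := by
  refine ⟨Metric.mem_closure_iff.2 fun e he => ⟨pt x (ψ x - e / 2), ⟨hx, ?_⟩, ?_⟩,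
    fun h => lt_irrefl _ (interior_subset h).2⟩
  · change ψ x - e / 2 < ψ x
    linarith
  · rw [dist_pt_pt, sub_sub_cancel, abs_of_pos (by linarith)]
    linarith

lemma signedDistFrontier_le_neg {P : Set (Base n)} {ψ : Base n → ℝ} {p : Ambient n} {ρ : ℝ}
    (hρ : 0 < ρ) (h : ball p ρ ⊆ obstacle P ψ) :
    signedDistFrontier (obstacle P ψ) p ≤ -ρ := by
  have hp : p ∈ obstacle P ψ := h (mem_ball_self hρ)
  rw [signedDistFrontier, if_pos hp, neg_le_neg_iff]
  refine (le_infDist ⟨_, pt_mem_frontier_obstacle ψ hp.1⟩).2 fun q hq => ?_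
  by_contra! hlt
  exact hq.2 (interior_maximal h isOpen_ball (mem_ball'.2 hlt))

lemma neg_le_signedDistFrontier {P : Set (Base n)} {ψ : Base n → ℝ} {p : Ambient n} {c : ℝ}
    (hc : 0 ≤ c) (h : p ∈ obstacle P ψ → ψ p.fst - p.snd ≤ c) :
    -c ≤ signedDistFrontier (obstacle P ψ) p := by
  unfold signedDistFrontier
  split_ifs with hp
  · rw [neg_le_neg_iff]
    refine (infDist_le_dist_of_mem (pt_mem_frontier_obstacle ψ hp.1)).trans ?_
    have := dist_pt_pt p.fst p.snd (ψ p.fst)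
    rw [abs_of_neg (sub_neg.2 hp.2), neg_sub] at this
    exact this.trans_le (h hp)
  · exact (neg_nonpos.2 hc).trans infDist_nonneg

/-- A `C¹` function on an open set is, uniformly on a compact subset, locally bounded below by cones
of slope only slightly larger than the norm of its derivative. -/
lemma exists_radius_forall_sub_le {P K : Set (Base n)} {ψ : Base n → ℝ} (hP : IsOpen P)
    (hψ : ContDiffOn ℝ 1 ψ P) (hK : IsCompact K) (hKP : K ⊆ P) :
    ∃ r > 0, ∀ x ∈ K, ∀ z, dist z x < r →
      z ∈ P ∧ ψ x - (1 + ‖fderiv ℝ ψ x‖) * dist z x ≤ ψ z := by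
  obtain ⟨r₁, hr₁, hr₁P⟩ := hK.exists_thickening_subset_open hP hKP
  have hc := hψ.continuousOn_fderiv_of_isOpen hP le_rfl
  have hunif := hK.uniformContinuousAt_of_continuousAt (fderiv ℝ ψ)
    (fun x hx => hc.continuousAt (hP.mem_nhds (hKP hx))) (dist_mem_uniformity one_pos)
  obtain ⟨r₂, hr₂, h₂⟩ := mem_uniformity_dist.1 hunif
  refine ⟨min r₁ r₂, lt_min hr₁ hr₂, fun x hx z hz => ?_⟩
  have hmem : ∀ y, dist y x < min r₁ r₂ → y ∈ P := fun y hy =>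
    hr₁P (mem_thickening_iff.2 ⟨x, hx, hy.trans_le (min_le_left _ _)⟩)
  refine ⟨hmem z hz, ?_⟩
  have hbound : ∀ y ∈ ball x (min r₁ r₂), ‖fderiv ℝ ψ y‖ ≤ 1 + ‖fderiv ℝ ψ x‖ := fun y hy => by
    have hd : dist (fderiv ℝ ψ x) (fderiv ℝ ψ y) < 1 :=
      h₂ ((dist_comm x y).trans_lt (hy.trans_le (min_le_right _ _))) hx
    rw [dist_comm, dist_eq_norm] at hd
    linarith [norm_sub_norm_le (fderiv ℝ ψ y) (fderiv ℝ ψ x)]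
  have := (convex_ball x (min r₁ r₂)).norm_image_sub_le_of_norm_fderiv_le
    (fun y hy => (hψ.contDiffAt (hP.mem_nhds (hmem y hy))).differentiableAt (by norm_num)) hbound
    (mem_ball_self (lt_min hr₁ hr₂)) hz
  rw [← dist_eq_norm, ← dist_eq_norm, Real.dist_eq] at this
  linarith [neg_abs_le (ψ z - ψ x)]

/-- Within the ball the cone drops by at most `(1 + Λ) * ρ` and the height rises by less than `ρ`,
which accounts for the factor `2 + Λ`. -/
lemma ball_pt_subset_obstacle {P : Set (Base n)} {ψ : Base n → ℝ} {x : Base n} {y r Λ ρ : ℝ}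
    (hΛ : 0 ≤ Λ) (hcone : ∀ z, dist z x < r → z ∈ P ∧ ψ x - (1 + Λ) * dist z x ≤ ψ z)
    (hρ : ρ ≤ r) (hy : y + (2 + Λ) * ρ ≤ ψ x) : ball (pt x y) ρ ⊆ obstacle P ψ := by
  intro q hq
  have h1 : dist q.fst x < ρ := (WithLp.dist_fst_le q (pt x y)).trans_lt hq
  have h2 : dist q.snd y < ρ := (WithLp.dist_snd_le q (pt x y)).trans_lt hq
  obtain ⟨hqP, hqψ⟩ := hcone q.fst (h1.trans_le hρ)
  refine ⟨hqP, ?_⟩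
  rw [Real.dist_eq] at h2
  nlinarith [le_abs_self (q.snd - y)]

/-! ### Compactness, curvature perturbation and the depth profile -/

namespace IsSmoothObstacle

variable {P : Set (Base n)} {ψ : Base n → ℝ}

lemma isCompact_superlevel (hψ : IsSmoothObstacle P ψ) (L : ℝ) :
    IsCompact {x | x ∈ P ∧ L ≤ ψ x} := by
  obtain ⟨M, hM⟩ := hψ.bddAbove
  convert (hψ.proper.isCompact_preimage (isCompact_Icc (a := L) (b := M))).image
    continuous_subtype_val using 1
  ext x
  constructor
  · rintro ⟨hx, hL⟩
    exact ⟨⟨x, hx⟩, ⟨hL, hM ⟨x, hx, rfl⟩⟩, rfl⟩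
  · rintro ⟨z, hz, rfl⟩
    exact ⟨z.2, hz.1⟩

lemma contDiffAt (hψ : IsSmoothObstacle P ψ) {x : Base n} (hx : x ∈ P) : ContDiffAt ℝ ∞ ψ x :=
  hψ.smooth.contDiffAt (hψ.isOpen.mem_nhds hx)

lemma continuousAt_fderiv (hψ : IsSmoothObstacle P ψ) {x : Base n} (hx : x ∈ P) :
    ContinuousAt (fderiv ℝ ψ) x :=
  ((hψ.contDiffAt hx).fderiv_right (m := 0) (by simp)).continuousAt

end IsSmoothObstacle

lemma continuousAt_fderiv_gradient {w : Base n → ℝ} {x : Base n} (hw : ContDiffAt ℝ 2 w x) :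
    ContinuousAt (fderiv ℝ (gradient w)) x :=
  ((contDiffAt_gradient hw).fderiv_right (m := 0) (by norm_num)).continuousAt

lemma continuousAt_divNormalizedGrad {w : Base n → ℝ} {x : Base n} (hw : ContDiffAt ℝ 2 w x) :
    ContinuousAt (divNormalizedGrad w) x := by
  have h := continuous_meanCurvatureForm.continuousAt.comp
    ((contDiffAt_gradient hw).continuousAt.prodMk (continuousAt_fderiv_gradient hw))
  refine h.congr ?_
  filter_upwards [hw.eventually (by simp)] with z hz using (divNormalizedGrad_eq hz).symm

/-- The curvature of the perturbed graph is jointly continuous in `(ε, x)` at `ε = 0`; the slack 1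
makes the inequality strict there, and compactness makes it uniform. -/
lemma eventually_divNormalizedGrad_sub_mul_ge {f g : Base n → ℝ} {K : Set (Base n)}
    (hK : IsCompact K) (hf : ∀ x ∈ K, ContDiffAt ℝ 2 f x) (hg : ∀ x ∈ K, ContDiffAt ℝ 2 g x) :
    ∀ᶠ ε : ℝ in 𝓝 0, ∀ x ∈ K,
      divNormalizedGrad f x - 1 ≤ divNormalizedGrad (fun z => f z - ε * g z) x := by
  refine hK.eventually_forall_of_forall_eventually
    (P := fun ε x => divNormalizedGrad f x - 1 ≤ divNormalizedGrad (fun z => f z - ε * g z) x)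
    fun x hx => ?_
  set F : ℝ × Base n → ℝ := fun q => meanCurvatureForm (gradient f q.2 - q.1 • gradient g q.2)
    (fderiv ℝ (gradient f) q.2 - q.1 • fderiv ℝ (gradient g) q.2) with hF
  have hFc : ContinuousAt F (0, x) := by
    have hgrad : ContinuousAt
        (fun q : ℝ × Base n => gradient f q.2 - q.1 • gradient g q.2) (0, x) :=
      (ContinuousAt.snd'' (f := gradient f) (contDiffAt_gradient (hf x hx)).continuousAt).sub
        (continuousAt_fst.smul
          (ContinuousAt.snd'' (f := gradient g) (contDiffAt_gradient (hg x hx)).continuousAt))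
    have hhess : ContinuousAt (fun q : ℝ × Base n =>
        fderiv ℝ (gradient f) q.2 - q.1 • fderiv ℝ (gradient g) q.2) (0, x) :=
      (ContinuousAt.snd'' (f := fderiv ℝ (gradient f))
        (continuousAt_fderiv_gradient (hf x hx))).sub
        (continuousAt_fst.smul (ContinuousAt.snd'' (f := fderiv ℝ (gradient g))
          (continuousAt_fderiv_gradient (hg x hx))))
    exact ContinuousAt.comp (f := fun q : ℝ × Base n => (gradient f q.2 - q.1 • gradient g q.2,
      fderiv ℝ (gradient f) q.2 - q.1 • fderiv ℝ (gradient g) q.2))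
      continuous_meanCurvatureForm.continuousAt (hgrad.prodMk hhess)
  have hHc : ContinuousAt (fun q : ℝ × Base n => divNormalizedGrad f q.2) (0, x) :=
    ContinuousAt.snd'' (continuousAt_divNormalizedGrad (hf x hx))
  have hlt : divNormalizedGrad f x - 1 < F (0, x) := by
    have h0 : divNormalizedGrad (fun z => f z - 0 * g z) x = F (0, x) := by
      rw [divNormalizedGrad_eq ((hf x hx).sub (contDiffAt_const.mul (hg x hx))),
        gradient_sub_mul _ ((hf x hx).differentiableAt (by norm_num))
          ((hg x hx).differentiableAt (by norm_num)),
        fderiv_gradient_sub_mul _ (hf x hx) (hg x hx)]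
    rw [← h0, show (fun z => f z - 0 * g z) = f by ext; ring]
    exact sub_one_lt _
  filter_upwards [(hHc.sub_const 1).eventually_lt hFc hlt,
    continuousAt_snd.eventually ((hf x hx).eventually (by simp)),
    continuousAt_snd.eventually ((hg x hx).eventually (by simp))] with q hq hfq hgq
  rw [divNormalizedGrad_eq (hfq.sub (contDiffAt_const.mul hgq)),
    gradient_sub_mul _ (hfq.differentiableAt (by norm_num)) (hgq.differentiableAt (by norm_num)),
    fderiv_gradient_sub_mul _ hfq hgq]
  exact hq.le

/-- There is a smooth depth profile `f` such that the penalisation at relative depth `f (ψ x)`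
beats the mean curvature of the graph of `ψ` at `x`. -/
lemma exists_depth_profile {P : Set (Base n)} {ψ : Base n → ℝ} (hψ : IsSmoothObstacle P ψ)
    {β : ℝ → ℝ} (hβ : Tendsto β atBot atTop) :
    ∃ f : ℝ → ℝ, ContDiff ℝ ∞ f ∧ ∀ h, 0 < f h ∧ ∀ x ∈ P, ψ x = h → ∀ c ≥ f h,
      1 + |divNormalizedGrad ψ x| ≤ β (-c / (2 + ‖fderiv ℝ ψ x‖)) := by
  let t : ℝ → Set ℝ := fun h => {a | 0 < a ∧ ∀ x ∈ P, ψ x = h → ∀ c ≥ a,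
      1 + |divNormalizedGrad ψ x| ≤ β (-c / (2 + ‖fderiv ℝ ψ x‖))}
  -- The condition asks for all `c ≥ a`, so admissible depths form an up-set, which is convex in
  -- `ℝ`; locally constant choices can then be glued by a partition of unity.
  have ht : ∀ h, Convex ℝ (t h) := fun h => by
    have : IsUpperSet (t h) := fun a b hab ha =>
      ⟨ha.1.trans_le hab, fun x hx hxh c hc => ha.2 x hx hxh c (hab.trans hc)⟩
    exact this.ordConnected.convex
  have hloc : ∀ h : ℝ, ∃ a, ∀ᶠ h' in 𝓝 h, a ∈ t h' := fun h => by
    -- A margin of 1 below `h` gives curvature and slope bounds valid for all heights near `h`.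
    have hKc := hψ.isCompact_superlevel (h - 1)
    obtain ⟨H, hH⟩ := (hKc.image_of_continuousOn (f := fun x => |divNormalizedGrad ψ x|)
      fun x hx => (continuousAt_divNormalizedGrad
        ((hψ.contDiffAt hx.1).of_le ENat.LEInfty.out)).abs.continuousWithinAt).bddAbove
    obtain ⟨Λ, hΛ⟩ := (hKc.image_of_continuousOn (f := fun x => ‖fderiv ℝ ψ x‖)
      fun x hx => (hψ.continuousAt_fderiv hx.1).norm.continuousWithinAt).bddAbove
    obtain ⟨N, hN⟩ := eventually_atBot.1 (hβ.eventually_ge_atTop (1 + H))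
    refine ⟨max 1 ((2 + Λ) * |N|), ?_⟩
    filter_upwards [lt_mem_nhds (sub_one_lt h)] with h' hh'
    refine ⟨by positivity, fun x hx hxh c hc => ?_⟩
    have hxK : x ∈ {x | x ∈ P ∧ h - 1 ≤ ψ x} := ⟨hx, hxh ▸ hh'.le⟩
    have hHx : |divNormalizedGrad ψ x| ≤ H := hH ⟨x, hxK, rfl⟩
    have hΛx : ‖fderiv ℝ ψ x‖ ≤ Λ := hΛ ⟨x, hxK, rfl⟩
    refine le_trans (by linarith) (hN _ ?_)
    have hpos : 0 < 2 + ‖fderiv ℝ ψ x‖ := by positivity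
    rw [div_le_iff₀ hpos]
    have h1 : (2 + Λ) * |N| ≤ c := (le_max_right _ _).trans hc
    nlinarith [abs_nonneg N, neg_abs_le N, mul_le_mul_of_nonneg_right hΛx (abs_nonneg N)]
  obtain ⟨f, hf⟩ := exists_contMDiffMap_forall_mem_convex_of_local_const
    (n := ⊤) (modelWithCornersSelf ℝ ℝ) ht hloc
  exact ⟨f, f.contMDiff.contDiff, hf⟩

end ObstacleMCF

/-! ### The barrier argument -/

theorem lemma6p1 (n : ℕ) (P : Set (ObstacleMCF.Base n)) (ψ : ObstacleMCF.Base n → ℝ)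
    (hψ : ObstacleMCF.IsSmoothObstacle P ψ)
    (β : ℝ → ℝ) (hβ : ObstacleMCF.IsPenaltyProfile β) :
    ∃ C₀ ε₀ : ℝ → ℝ, (∀ ℓ, 1 < C₀ ℓ) ∧ (∀ L, 0 < ε₀ L) ∧
      ∀ ℓ L R : ℝ, L < ℓ → 0 < R →
        (∀ x ∈ P, x ∉ Metric.ball (0 : ObstacleMCF.Base n) R → ψ x < L) →
      ∀ ε : ℝ, 0 < ε → ε ≤ ε₀ L →
      ∀ (T : EReal) (u₀ : ObstacleMCF.Base n → ℝ) (u : ObstacleMCF.Base n → ℝ → ℝ),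
        (∀ x ∈ Metric.ball (0 : ObstacleMCF.Base n) R, L ≤ u₀ x ∧ (x ∈ P → ψ x ≤ u₀ x)) →
        ObstacleMCF.IsPenalisedSolution β (ObstacleMCF.obstacle P ψ) ε L R T u₀ u →
      ∀ t : ℝ, 0 ≤ t → (t : EReal) < T →
      ∀ p ∈ ObstacleMCF.graphOver R (fun x => u x t), ℓ ≤ p.snd →
        -(C₀ ℓ * ε) ≤ ObstacleMCF.signedDistFrontier (ObstacleMCF.obstacle P ψ) p := by
  obtain ⟨f, hfs, hf⟩ := ObstacleMCF.exists_depth_profile hψ hβ.tendsto_atBot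
  have hfψ : ∀ x ∈ P, ContDiffAt ℝ 2 (fun z => f (ψ z)) x := fun x hx =>
    (hfs.contDiffAt.comp x (hψ.contDiffAt hx)).of_le ENat.LEInfty.out
  have hψ2 : ∀ x ∈ P, ContDiffAt ℝ 2 ψ x := fun x hx =>
    (hψ.contDiffAt hx).of_le ENat.LEInfty.out
  have hC : ∀ ℓ : ℝ, ∃ C : ℝ, 1 < C ∧ ∀ x ∈ P, ℓ ≤ ψ x → f (ψ x) ≤ C := fun ℓ => by
    obtain ⟨M, hM⟩ := ((hψ.isCompact_superlevel ℓ).image_of_continuousOn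
      (f := fun z => f (ψ z)) fun x hx => (hfψ x hx.1).continuousAt.continuousWithinAt).bddAbove
    exact ⟨max 2 M, lt_max_of_lt_left one_lt_two,
      fun x hx hℓ => (hM ⟨x, ⟨hx, hℓ⟩, rfl⟩).trans (le_max_right _ _)⟩
  have hε : ∀ L : ℝ, ∃ ε₀ : ℝ, 0 < ε₀ ∧ ∀ ε : ℝ, 0 < ε → ε ≤ ε₀ → ∀ x ∈ P, L ≤ ψ x →
      ObstacleMCF.divNormalizedGrad ψ x - 1 ≤
        ObstacleMCF.divNormalizedGrad (fun z => ψ z - ε * f (ψ z)) x ∧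
      ∀ y, ∀ ρ, y + (2 + ‖fderiv ℝ ψ x‖) * ρ ≤ ψ x → ρ ≤ ε * f (ψ x) →
        ball (ObstacleMCF.pt x y) ρ ⊆ ObstacleMCF.obstacle P ψ := fun L => by
    have hKc := hψ.isCompact_superlevel L
    obtain ⟨r, hr, hcone⟩ := ObstacleMCF.exists_radius_forall_sub_le hψ.isOpen
      (hψ.smooth.of_le (mod_cast (le_top : (1 : ℕ∞) ≤ ⊤))) hKc fun x hx => hx.1
    have hsmall : ∀ᶠ ε in nhds (0 : ℝ), ∀ x ∈ {x | x ∈ P ∧ L ≤ ψ x}, ε * f (ψ x) < r := by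
      refine hKc.eventually_forall_of_forall_eventually (P := fun ε x => ε * f (ψ x) < r)
        fun x hx => ?_
      have hc : ContinuousAt (fun q : ℝ × ObstacleMCF.Base n => q.1 * f (ψ q.2)) (0, x) :=
        continuousAt_fst.mul (ContinuousAt.snd'' (f := fun z => f (ψ z)) (hfψ x hx.1).continuousAt)
      exact hc.eventually_lt continuousAt_const (by simpa using hr)
    obtain ⟨δ, hδ, h⟩ := Metric.eventually_nhds_iff.1 (hsmall.and
      (ObstacleMCF.eventually_divNormalizedGrad_sub_mul_ge hKc (fun x hx => hψ2 x hx.1)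
        fun x hx => hfψ x hx.1))
    refine ⟨δ / 2, by linarith, fun ε hε0 hεδ x hx hL => ?_⟩
    obtain ⟨h1, h2⟩ := h (y := ε) (by rw [Real.dist_eq, sub_zero, abs_of_pos hε0]; linarith)
    exact ⟨h2 x ⟨hx, hL⟩, fun y ρ hy hρ => ObstacleMCF.ball_pt_subset_obstacle (norm_nonneg _)
      (hcone x ⟨hx, hL⟩) (hρ.trans (h1 x ⟨hx, hL⟩).le) hy⟩
  choose C₀ hC₀ hfC using hC
  choose ε₀ hε₀ hbar using hε
  refine ⟨C₀, ε₀, hC₀, hε₀, fun ℓ L R hLℓ _ hout ε hε0 hεε₀ T u₀ u hu₀ hu t ht0 htT p hp hpℓ => ?_⟩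
  refine ObstacleMCF.neg_le_signedDistFrontier
    (mul_nonneg (by linarith [hC₀ ℓ]) hε0.le) fun hpO => ?_
  have hKb : {x | x ∈ P ∧ L ≤ ψ x} ⊆ ball (0 : ObstacleMCF.Base n) R := fun x hx => by
    by_contra h
    exact absurd (hout x hx.1 h) (not_lt.2 hx.2)
  have hfpos : ∀ x, 0 < ε * f (ψ x) := fun x => mul_pos hε0 (hf _).1
  have hpψ : ℓ ≤ ψ p.fst := hpℓ.trans hpO.2.le
  have hw2 : ∀ x ∈ P, ContDiffAt ℝ 2 (fun z => ψ z - ε * f (ψ z)) x := fun x hx =>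
    (hψ2 x hx).sub (contDiffAt_const.mul (hfψ x hx))
  have key : ψ p.fst - ε * f (ψ p.fst) ≤ u p.fst t := by
    -- Comparison takes place on `{ψ ≥ L}` with interior part `{ψ > L}`. This set lies in the open
    -- ball, so its edge is `{ψ = L}` and the boundary of the ball plays no direct role.
    refine hu.le_of_subsolution (w := fun z => ψ z - ε * f (ψ z)) (U := P ∩ ψ ⁻¹' Ioi L)
      (hψ.isCompact_superlevel L) (hKb.trans ball_subset_closedBall)
      (hψ.smooth.continuousOn.isOpen_inter_preimage hψ.isOpen isOpen_Ioi)
      (fun x hx => ⟨hx.1, le_of_lt hx.2⟩) (fun x hx => hKb ⟨hx.1, le_of_lt hx.2⟩)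
      (fun x hx => (hw2 x hx.1).continuousAt.continuousWithinAt) (fun x hx => hw2 x hx.1)
      ?_ ?_ ?_ t ht0 htT p.fst ⟨hpO.1, hLℓ.le.trans hpψ⟩
    · intro x hx y hy
      obtain ⟨hH, hball⟩ := hbar L ε hε0 hεε₀ x hx.1 (le_of_lt hx.2)
      have hΛ : 0 < 2 + ‖fderiv ℝ ψ x‖ := by positivity
      have hd := ObstacleMCF.signedDistFrontier_le_neg (div_pos (hfpos x) hΛ) (hball y _
        (by rw [mul_div_cancel₀ _ hΛ.ne']; linarith)
        (div_le_self (hfpos x).le (by linarith [norm_nonneg (fderiv ℝ ψ x)])))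
      set d := ObstacleMCF.signedDistFrontier (ObstacleMCF.obstacle P ψ) (ObstacleMCF.pt x y)
      -- This `c` makes the argument of `β` exactly `d / ε`; the distance bound `hd` says that it is
      -- at least `f (ψ x)`. No monotonicity of `β` is invoked.
      have hβd := (hf _).2 x hx.1 rfl (-(d / ε) * (2 + ‖fderiv ℝ ψ x‖)) (by
        rw [ge_iff_le, ← div_le_iff₀ hΛ, le_neg, div_le_iff₀ hε0]
        refine hd.trans_eq ?_
        ring)
      rw [neg_mul, neg_neg, mul_div_cancel_right₀ _ hΛ.ne'] at hβd
      have : ObstacleMCF.penalty β (ObstacleMCF.obstacle P ψ) ε (ObstacleMCF.pt x y) = β (d / ε) :=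
        rfl
      rw [this]
      linarith [neg_abs_le (ObstacleMCF.divNormalizedGrad ψ x)]
    · intro x hx hxU s hs0 hsT
      have hL : ψ x ≤ L := not_lt.1 fun h => hxU ⟨hx.1, h⟩
      have := hu.boundaryValue_le hβ.nonneg (fun z hz => (hu₀ z hz).1) s hs0 hsT x
        (ball_subset_closedBall (hKb hx))
      linarith [hfpos x]
    · intro x hx
      rw [hu.initial x (hKb hx)]
      linarith [hfpos x, (hu₀ x (hKb hx)).2 hx.1]
  have hpu : p.snd = u p.fst t := hp.2
  have := mul_le_mul_of_nonneg_left (hfC ℓ p.fst hpO.1 hpψ) hε0.le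
  rw [hpu]
  linarith
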